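/- Let $0<q<1$ and let $\nu>-1$ be real with $\nu\notin\{1,2,3,\dots\}$. Put $\mathbb R_q^+=\{q^n: n\in\mathbb Z\}$, $(a;p)_n=\prod_{i=0}^{n-1}(1-ap^i)$ for $n=0,1,\dots,\infty$, $\int_0^\infty f(x)\,d_qx=(1-q)\sum_{n\in\mathbb Z}q^nf(q^n)$, $$j_\nu(x,q^2)=\sum_{n=0}^\infty(-1)^n\frac{q^{n(n+1)}}{(q^2;q^2)_n(q^{2\nu+2};q^2)_n}x^{2n},\qquad c_{q,\nu}=\frac1{1-q}\frac{(q^{2\nu+2};q^2)_\infty}{(q^2;q^2)_\infty}.$$ Let $L^1_{q,\nu}$ be the set of real functions $f$ on $\mathbb R_q^+$ with $\int_0^\infty|f(x)|x^{2\nu+1}d_qx<\infty$, and let $\mathcal F_{q,\nu}f(x)=c_{q,\nu}\int_0^\infty f(t)j_\nu(xt,q^2)t^{2\nu+1}d_qt$ for $x\in\mathbb R_q^+$ be the $q$-Bessel Fourier transform. Then for every $x\in\mathbb R_q^+$ the $q$-integral defining the $q$-Macdonald function $$K_\nu(x,q^2)=c_{q,\nu}\int_0^\infty\frac{1}{1+t^2}\,j_\nu(tx,q^2)\,t^{2\nu+1}d_qt$$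 converges absolutely; the function $K_\nu(\cdot,q^2)$ belongs to $L^1_{q,\nu}$; and for every $x\in\mathbb R_q^+$ the $q$-integral defining $\mathcal F_{q,\nu}(K_\nu)(x)$ converges absolutely and $$\mathcal F_{q,\nu}(K_\nu)(x)=\frac1{1+x^2}.$$ -/

import Mathlib

noncomputable section

namespace QBessel

/-- The `q`-half-line `{q ^ n : n ∈ ℤ}`. -/
def qHalfLine (q : ℝ) : Set ℝ := Set.range fun n : ℤ => q ^ n

/-- The finite `q`-shifted factorial `(a; p)_n = ∏_{i < n} (1 - a p ^ i)`. -/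
def qPoch (a p : ℝ) (n : ℕ) : ℝ := ∏ i ∈ Finset.range n, (1 - a * p ^ i)

/-- The infinite `q`-shifted factorial `(a; p)_∞ = ∏_{i ≥ 0} (1 - a p ^ i)`
(the product converges for `0 < p < 1`). -/
def qPochInf (a p : ℝ) : ℝ := ∏' i : ℕ, (1 - a * p ^ i)

/-- The normalized Hahn–Exton (third Jackson) `q`-Bessel function `j_ν(x; p)`, in base `p`:
`∑ (-1)^n p^{n(n+1)/2} / ((p; p)_n (p^{ν+1}; p)_n) x^{2n}`.
The series converges for all `x` when `0 < p < 1` and `ν > -1`;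
the natural-number division by `2` is exact. -/
def besselj (ν x p : ℝ) : ℝ :=
  ∑' n : ℕ, (-1) ^ n * p ^ (n * (n + 1) / 2) / (qPoch p p n * qPoch (p ^ (ν + 1)) p n)
    * x ^ (2 * n)

/-- (Absolute) convergence of the Jackson `q`-integral of `f` over `(0, ∞)`. -/
def JacksonIntegrable (q : ℝ) (f : ℝ → ℝ) : Prop :=
  Summable fun n : ℤ => q ^ n * f (q ^ n)

/-- The Jackson `q`-integral `∫_0^∞ f(x) d_q x = (1 - q) ∑_{n ∈ ℤ} q^n f(q^n)`. -/
def jacksonIntegral (q : ℝ) (f : ℝ → ℝ) : ℝ :=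
  (1 - q) * ∑' n : ℤ, q ^ n * f (q ^ n)

/-- The space `L^p_{q,ν}` of real functions `f` on the `q`-half-line with
`∫_0^∞ |f(x)|^p x^{2ν+1} d_q x < ∞`. Only the values of `f` at the points `q ^ n` matter. -/
def qLp (q p ν : ℝ) : Set (ℝ → ℝ) :=
  {f | JacksonIntegrable q fun x => |f x| ^ p * x ^ (2 * ν + 1)}

/-- The constant `c_{q,ν} = (q^{2ν+2}; q²)_∞ / ((1 - q) (q²; q²)_∞)`. -/
def cConst (q ν : ℝ) : ℝ :=
  1 / (1 - q) * (qPochInf (q ^ (2 * ν + 2)) (q ^ 2) / qPochInf (q ^ 2) (q ^ 2))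

/-- The integrand `t ↦ f(t) j_ν(x t; q²) t^{2ν+1}` of the `q`-Bessel Fourier transform. -/
def fourierIntegrand (q ν : ℝ) (f : ℝ → ℝ) (x : ℝ) : ℝ → ℝ :=
  fun t => f t * besselj ν (x * t) (q ^ 2) * t ^ (2 * ν + 1)

/-- The `q`-Bessel Fourier transform
`F_{q,ν} f(x) = c_{q,ν} ∫_0^∞ f(t) j_ν(x t; q²) t^{2ν+1} d_q t`. -/
def qFourier (q ν : ℝ) (f : ℝ → ℝ) (x : ℝ) : ℝ :=
  cConst q ν * jacksonIntegral q (fourierIntegrand q ν f x)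

/-- The integrand `t ↦ (1 + t²)⁻¹ j_ν(t x; q²) t^{2ν+1}` of the `q`-Macdonald function. -/
def macdonaldIntegrand (q ν x : ℝ) : ℝ → ℝ :=
  fun t => (1 + t ^ 2)⁻¹ * besselj ν (t * x) (q ^ 2) * t ^ (2 * ν + 1)

/-- The `q`-Macdonald function
`K_ν(x; q²) = c_{q,ν} ∫_0^∞ (1 + t²)⁻¹ j_ν(t x; q²) t^{2ν+1} d_q t`. -/
def macdonaldK (q ν x : ℝ) : ℝ :=
  cConst q ν * jacksonIntegral q (macdonaldIntegrand q ν x)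

end QBessel

end

noncomputable section

namespace QBessel

open Filter Topology

/-! Put `p = q ^ 2`, `w = p ^ (ν + 1)`, and write `h` for `hahnExton p w`. On the lattice, `h m` is
the normalized Bessel value at `q ^ m` (`cConst_mul_besselj`) and the measure `t ^ (2ν + 1) d_q t`
gives the weight `w ^ n`, so the transform sends a sequence `f` to `l ↦ ∑ w ^ k f k h (l + k)`. The
`h m` are the Laurent coefficients of `G(z) = (w / z; p)_∞ / (z; p)_∞`. Comparing coefficients in
`G(z) G(w / z) = 1` gives `∑ w ^ m h m h (m + s) = δ_{s,0}` (`tsum_zpow_mul_hahnExton_mul`), which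
makes the transform formally its own inverse. As `K_ν` is the transform of `1 / (1 + t²)`, the
formula follows once Fubini is justified (`tsum_macdonaldCoeff_mul_hahnExton`). All convergence
rests on `h` being bounded at `+∞` and decaying faster than any geometric sequence at `-∞`
(`exists_hahnExton_bound`). Integrability of `K_ν` at infinity also needs the cancellation `∑ w ^ m
h m = 0` (`tsum_zpow_mul_hahnExton`). -/

/-! ### Euler's series for `(z; p)_∞` and its reciprocal. -/

/-- The coefficients `1 / (p; p)_n` of `1 / (z; p)_∞`, extended by zero to `ℤ`. -/
def invEulerCoeff (p : ℝ) : ℤ → ℝ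
  | Int.ofNat n => (qPoch p p n)⁻¹
  | Int.negSucc _ => 0

/-- The coefficients `(-1)^n p^{n(n-1)/2} / (p; p)_n` of `(z; p)_∞`, extended by zero to `ℤ`. -/
def eulerCoeff (p : ℝ) : ℤ → ℝ
  | Int.ofNat n => (-1) ^ n * p ^ n.choose 2 / qPoch p p n
  | Int.negSucc _ => 0

theorem invEulerCoeff_natCast (p : ℝ) (n : ℕ) : invEulerCoeff p n = (qPoch p p n)⁻¹ := rfl

theorem eulerCoeff_natCast (p : ℝ) (n : ℕ) :
    eulerCoeff p n = (-1) ^ n * p ^ n.choose 2 / qPoch p p n := rfl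

theorem invEulerCoeff_of_neg (p : ℝ) {n : ℤ} (hn : n < 0) : invEulerCoeff p n = 0 := by
  obtain ⟨k, rfl⟩ := Int.eq_negSucc_of_lt_zero hn
  rfl

theorem eulerCoeff_of_neg (p : ℝ) {n : ℤ} (hn : n < 0) : eulerCoeff p n = 0 := by
  obtain ⟨k, rfl⟩ := Int.eq_negSucc_of_lt_zero hn
  rfl

theorem qPoch_zero (a p : ℝ) : qPoch a p 0 = 1 := by simp [qPoch]

theorem qPoch_succ (a p : ℝ) (n : ℕ) : qPoch a p (n + 1) = qPoch a p n * (1 - a * p ^ n) := by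
  simp [qPoch, Finset.prod_range_succ]

section

variable {p : ℝ} (hp0 : 0 < p) (hp1 : p < 1)
include hp0 hp1

theorem one_sub_mul_pow_pos {a : ℝ} (ha : a < 1) (n : ℕ) : 0 < 1 - a * p ^ n := by
  have h1 : p ^ n ≤ 1 := pow_le_one₀ hp0.le hp1.le
  have h2 : 0 < p ^ n := pow_pos hp0 n
  nlinarith [mul_lt_mul_of_pos_right ha h2]

theorem qPoch_pos {a : ℝ} (ha : a < 1) (n : ℕ) : 0 < qPoch a p n :=
  Finset.prod_pos fun i _ => one_sub_mul_pow_pos hp0 hp1 ha i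

theorem summable_mul_pow (a : ℝ) : Summable fun i : ℕ => a * p ^ i :=
  (summable_geometric_of_lt_one hp0.le hp1).mul_left a

theorem multipliable_qPoch (a : ℝ) : Multipliable fun i : ℕ => 1 - a * p ^ i := by
  simpa [sub_eq_add_neg] using
    Real.multipliable_one_add_of_summable (summable_mul_pow hp0 hp1 a).neg

theorem tendsto_qPoch (a : ℝ) :
    Tendsto (fun n => qPoch a p n) atTop (𝓝 (qPochInf a p)) :=
  (multipliable_qPoch hp0 hp1 a).tendsto_prod_tprod_nat

theorem qPochInf_ne_zero {a : ℝ} (ha : a < 1) : qPochInf a p ≠ 0 := by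
  have h := tprod_one_add_ne_zero_of_summable (f := fun i : ℕ => -(a * p ^ i))
    (fun i => by
      have := one_sub_mul_pow_pos hp0 hp1 ha i
      rw [← sub_eq_add_neg]; exact this.ne')
    (by simpa using (summable_mul_pow hp0 hp1 a).norm)
  simpa [qPochInf, sub_eq_add_neg] using h

theorem qPochInf_eq_qPoch_mul (a : ℝ) (n : ℕ) :
    qPochInf a p = qPoch a p n * qPochInf (a * p ^ n) p := by
  have h1 := (tendsto_qPoch hp0 hp1 a).comp (tendsto_add_atTop_nat n)
  have h2 := (tendsto_qPoch hp0 hp1 (a * p ^ n)).const_mul (qPoch a p n)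
  refine tendsto_nhds_unique h1 (h2.congr fun m => ?_)
  simp only [Function.comp, qPoch]
  rw [add_comm m n, Finset.prod_range_add]
  simp [pow_add, mul_assoc]

theorem invEulerCoeff_nonneg (n : ℤ) : 0 ≤ invEulerCoeff p n := by
  cases n with
  | ofNat n => exact (inv_pos.2 (qPoch_pos hp0 hp1 hp1 n)).le
  | negSucc n => exact le_rfl

theorem exists_invEulerCoeff_le : ∃ C, 0 < C ∧ ∀ n : ℤ, invEulerCoeff p n ≤ C := by
  obtain ⟨C, hC⟩ :=
    ((tendsto_qPoch hp0 hp1 p).inv₀ (qPochInf_ne_zero hp0 hp1 hp1)).bddAbove_range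
  refine ⟨max C 1, by positivity, fun n => ?_⟩
  cases n with
  | ofNat n => exact (hC ⟨n, rfl⟩).trans (le_max_left _ _)
  | negSucc n => exact zero_le_one.trans (le_max_right _ _)

/-- Coefficient form of `F(pz) = (1 - z) F(z)` for `F(z) = 1 / (z; p)_∞`; the extension by zero
makes it valid at every integer. -/
theorem invEulerCoeff_sub_one (n : ℤ) :
    invEulerCoeff p (n - 1) = invEulerCoeff p n * (1 - p ^ n) := by
  rcases lt_trichotomy n 0 with hn | rfl | hn
  · rw [invEulerCoeff_of_neg p hn, invEulerCoeff_of_neg p (by lia), zero_mul]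
  · simp [invEulerCoeff_of_neg]
  · obtain ⟨k, rfl⟩ : ∃ k : ℕ, n = ((k + 1 : ℕ) : ℤ) := ⟨(n - 1).toNat, by lia⟩
    rw [invEulerCoeff_natCast, zpow_natCast, qPoch_succ,
      show ((k + 1 : ℕ) : ℤ) - 1 = (k : ℕ) by push_cast; ring, invEulerCoeff_natCast]
    have h1 := (qPoch_pos hp0 hp1 hp1 k).ne'
    have h2 := (one_sub_mul_pow_pos hp0 hp1 hp1 k).ne'
    rw [← pow_succ'] at *
    field_simp

/-- Coefficient form of `(z; p)_∞ = (1 - z) (pz; p)_∞`. -/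
theorem eulerCoeff_sub_one (n : ℤ) :
    p ^ (n - 1) * eulerCoeff p (n - 1) = eulerCoeff p n * (p ^ n - 1) := by
  rcases lt_trichotomy n 0 with hn | rfl | hn
  · rw [eulerCoeff_of_neg p hn, eulerCoeff_of_neg p (by lia), zero_mul, mul_zero]
  · simp [eulerCoeff_of_neg]
  · obtain ⟨k, rfl⟩ : ∃ k : ℕ, n = ((k + 1 : ℕ) : ℤ) := ⟨(n - 1).toNat, by lia⟩
    rw [eulerCoeff_natCast, zpow_natCast, qPoch_succ,
      show ((k + 1 : ℕ) : ℤ) - 1 = (k : ℕ) by push_cast; ring, eulerCoeff_natCast, zpow_natCast,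
      Nat.choose_succ_succ' k 1, Nat.choose_one_right, pow_add, pow_succ (-1 : ℝ)]
    have h1 := (qPoch_pos hp0 hp1 hp1 k).ne'
    have h2 := (one_sub_mul_pow_pos hp0 hp1 hp1 k).ne'
    rw [← pow_succ'] at *
    field_simp
    ring

/-- The factor `p ^ (n.choose 2)` beats any geometric growth: the term ratio is `B p ^ n / (1 - p ^
(n + 1))`, which tends to `0`. -/
theorem summable_eulerCoeff_mul_zpow {B : ℝ} (hB : 0 < B) :
    Summable fun n : ℤ => |eulerCoeff p n| * B ^ n := by
  rw [← (Nat.cast_injective (R := ℤ)).summable_iff fun n hn => ?_]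
  · refine summable_of_ratio_test_tendsto_lt_one (l := 0) one_pos (Eventually.of_forall fun n => ?_)
      (Tendsto.congr (f₁ := fun n : ℕ => B * p ^ n / (1 - p * p ^ n)) (fun n => ?_) ?_)
    · have h1 := (qPoch_pos hp0 hp1 hp1 n).ne'
      simp only [Function.comp, eulerCoeff_natCast]
      positivity
    · have h1 := (qPoch_pos hp0 hp1 hp1 n)
      have h2 := (one_sub_mul_pow_pos hp0 hp1 hp1 n)
      have h3 := (qPoch_pos hp0 hp1 hp1 (n + 1))
      simp only [Function.comp, eulerCoeff_natCast, norm_mul, norm_div, abs_div, abs_mul, abs_pow,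
        norm_pow, Real.norm_eq_abs, abs_neg, abs_one, one_pow, abs_of_pos hp0,
        abs_of_pos h1, abs_of_pos h3, zpow_natCast, abs_of_pos hB]
      rw [qPoch_succ, Nat.choose_succ_succ' n 1, Nat.choose_one_right, pow_add, pow_succ B]
      field_simp
    · have h := tendsto_pow_atTop_nhds_zero_of_lt_one hp0.le hp1
      have h' := (h.const_mul B).div ((h.const_mul p).const_sub 1) (by simp)
      rw [mul_zero, zero_div] at h'
      exact h'
  · rw [eulerCoeff_of_neg p, abs_zero, zero_mul]
    by_contra! h
    exact hn ⟨n.toNat, by simp [h]⟩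

/-- The two Euler series are reciprocal. Their formal product is invariant under `z ↦ pz`, so its
coefficient at `t` is fixed by multiplication by `p ^ t` and vanishes for `t ≠ 0`. -/
theorem tsum_invEulerCoeff_mul_eulerCoeff (t : ℤ) :
    ∑' r : ℤ, invEulerCoeff p (t - r) * eulerCoeff p r = if t = 0 then 1 else 0 := by
  obtain ⟨C, hC0, hC⟩ := exists_invEulerCoeff_le hp0 hp1
  have hbd : ∀ s : ℤ, |invEulerCoeff p s| ≤ C := fun s => by
    rw [abs_of_nonneg (invEulerCoeff_nonneg hp0 hp1 s)]; exact hC s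
  split_ifs with ht
  · subst ht
    rw [tsum_eq_single 0 fun r hr => ?_]
    · have h1 := invEulerCoeff_natCast p 0
      have h2 := eulerCoeff_natCast p 0
      simp only [Nat.cast_zero] at h1 h2
      simp [h1, h2, qPoch_zero]
    · rcases lt_or_gt_of_ne hr with h | h
      · rw [eulerCoeff_of_neg p h, mul_zero]
      · rw [invEulerCoeff_of_neg p (by lia), zero_mul]
  · have hs : ∀ (s : ℤ), Summable fun r : ℤ =>
        invEulerCoeff p (s - r) * (p ^ r * eulerCoeff p r) := fun s => by
      refine ((summable_eulerCoeff_mul_zpow hp0 hp1 hp0).mul_left C).of_norm_bounded fun r => ?_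
      rw [norm_mul, norm_mul, Real.norm_eq_abs, Real.norm_eq_abs, Real.norm_eq_abs,
        abs_of_pos (zpow_pos hp0 r), mul_comm (p ^ r)]
      exact mul_le_mul_of_nonneg_right (hbd _) (by positivity)
    have key : p ^ t * ∑' r : ℤ, invEulerCoeff p (t - r) * eulerCoeff p r =
        ∑' r : ℤ, invEulerCoeff p (t - r) * eulerCoeff p r := by
      have hs' : Summable fun r : ℤ => invEulerCoeff p (t - 1 - (r - 1)) *
          (p ^ (r - 1) * eulerCoeff p (r - 1)) :=
        (Equiv.subRight (1 : ℤ)).summable_iff.2 (hs (t - 1))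
      calc p ^ t * ∑' r : ℤ, invEulerCoeff p (t - r) * eulerCoeff p r
          = ∑' r : ℤ, (invEulerCoeff p (t - r) * (p ^ r * eulerCoeff p r) -
              invEulerCoeff p (t - 1 - r) * (p ^ r * eulerCoeff p r)) := by
            rw [← tsum_mul_left]
            refine tsum_congr fun r => ?_
            rw [show t - 1 - r = t - r - 1 by ring, invEulerCoeff_sub_one hp0 hp1,
              zpow_sub₀ hp0.ne']
            field_simp
            ring
        _ = ∑' r : ℤ, (invEulerCoeff p (t - r) * (p ^ r * eulerCoeff p r) -
              invEulerCoeff p (t - 1 - (r - 1)) * (p ^ (r - 1) * eulerCoeff p (r - 1))) := by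
            rw [(hs t).tsum_sub (hs (t - 1)), (hs t).tsum_sub hs']
            congr 1
            exact ((Equiv.subRight (1 : ℤ)).tsum_eq fun r =>
              invEulerCoeff p (t - 1 - r) * (p ^ r * eulerCoeff p r)).symm
        _ = ∑' r : ℤ, invEulerCoeff p (t - r) * eulerCoeff p r := by
            refine tsum_congr fun r => ?_
            rw [eulerCoeff_sub_one hp0 hp1, show t - 1 - (r - 1) = t - r by ring]
            ring
    have hpt : p ^ t ≠ 1 := fun h => ht ((zpow_eq_one_iff_right₀ hp0.le hp1.ne).1 h)
    exact (mul_eq_zero.1 (show (p ^ t - 1) * _ = 0 by linear_combination key)).resolve_left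
      (sub_ne_zero.2 hpt)

end

/-! ### Hahn–Exton coefficients: bounds and identification with the Bessel series. -/

/-- The Hahn–Exton coefficients `∑_n (-1)^n p^{n(n-1)/2} w^n / ((p; p)_n (p; p)_{n+m})`, the
Laurent coefficients of `(w / z; p)_∞ / (z; p)_∞` in the annulus `0 < |z| < 1`. -/
def hahnExton (p w : ℝ) (m : ℤ) : ℝ :=
  ∑' n : ℤ, eulerCoeff p n * w ^ n * invEulerCoeff p (n + m)

theorem tsum_int_eq_tsum_nat {f : ℤ → ℝ} (hf : ∀ n < 0, f n = 0) :
    ∑' n : ℤ, f n = ∑' n : ℕ, f n := by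
  refine ((Nat.cast_injective (R := ℤ)).tsum_eq fun n hn => ?_).symm
  by_contra h
  refine hn (hf n ?_)
  by_contra! h'
  exact h ⟨n.toNat, by simp [h']⟩

section

variable {p : ℝ} (hp0 : 0 < p) (hp1 : p < 1)
include hp0 hp1

theorem summable_nat_eulerCoeff_mul_pow {B : ℝ} (hB : 0 < B) :
    Summable fun n : ℕ => |eulerCoeff p n| * B ^ n := by
  simpa [Function.comp_def] using
    (summable_eulerCoeff_mul_zpow hp0 hp1 hB).comp_injective (Nat.cast_injective (R := ℤ))

theorem tsum_eulerCoeff_mul_pow_eq_mul (z : ℝ) :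
    ∑' n : ℕ, eulerCoeff p n * z ^ n = (1 - z) * ∑' n : ℕ, eulerCoeff p n * (z * p) ^ n := by
  have hs : ∀ y : ℝ, Summable fun n : ℕ => eulerCoeff p n * y ^ n := fun y => by
    refine (summable_nat_eulerCoeff_mul_pow hp0 hp1
      (show 0 < |y| + 1 by positivity)).of_norm_bounded fun n => ?_
    rw [norm_mul, norm_pow, Real.norm_eq_abs, Real.norm_eq_abs]
    gcongr
    linarith
  have hrec : ∀ n : ℕ, eulerCoeff p (n + 1 : ℕ) * (1 - p ^ (n + 1)) = - (p ^ n * eulerCoeff p n) := by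
    intro n
    have h := eulerCoeff_sub_one hp0 hp1 ((n + 1 : ℕ) : ℤ)
    rw [show ((n + 1 : ℕ) : ℤ) - 1 = (n : ℕ) by push_cast; ring, zpow_natCast, zpow_natCast] at h
    linarith
  have h0 := (hs z).sub (hs (z * p))
  have hd : ∑' n : ℕ, eulerCoeff p n * z ^ n - ∑' n : ℕ, eulerCoeff p n * (z * p) ^ n =
      -z * ∑' n : ℕ, eulerCoeff p n * (z * p) ^ n := by
    rw [← (hs z).tsum_sub (hs (z * p)), h0.tsum_eq_zero_add, ← tsum_mul_left]
    simp only [pow_zero, sub_self, zero_add]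
    refine tsum_congr fun n => ?_
    rw [mul_pow, mul_pow]
    linear_combination z ^ (n + 1) * hrec n
  linarith

theorem tsum_eulerCoeff_mul_pow (z : ℝ) :
    ∑' n : ℕ, eulerCoeff p n * z ^ n = qPochInf z p := by
  have hiter : ∀ k : ℕ, ∑' n : ℕ, eulerCoeff p n * z ^ n =
      qPoch z p k * ∑' n : ℕ, eulerCoeff p n * (z * p ^ k) ^ n := by
    intro k
    induction k with
    | zero => simp [qPoch_zero]
    | succ k ih =>
      rw [ih, tsum_eulerCoeff_mul_pow_eq_mul hp0 hp1 (z * p ^ k), qPoch_succ, pow_succ]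
      ring_nf
  have hlim : Tendsto (fun k : ℕ => ∑' n : ℕ, eulerCoeff p n * (z * p ^ k) ^ n) atTop
      (𝓝 (∑' n : ℕ, eulerCoeff p n * (z * 0) ^ n)) := by
    refine tendsto_tsum_of_dominated_convergence
      (summable_nat_eulerCoeff_mul_pow hp0 hp1 (show 0 < |z| + 1 by positivity))
      (fun n => (((tendsto_pow_atTop_nhds_zero_of_lt_one hp0.le hp1).const_mul z).pow n).const_mul _)
      (Eventually.of_forall fun k n => ?_)
    have hk : p ^ k ≤ 1 := pow_le_one₀ hp0.le hp1.le
    rw [norm_mul, norm_pow, norm_mul, Real.norm_eq_abs, Real.norm_eq_abs, Real.norm_eq_abs,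
      abs_of_pos (pow_pos hp0 k)]
    gcongr
    nlinarith [mul_le_mul_of_nonneg_left hk (abs_nonneg z)]
  have h1 : ∑' n : ℕ, eulerCoeff p n * (z * 0) ^ n = 1 := by
    rw [tsum_eq_single 0 fun n hn => by simp [hn]]
    rw [eulerCoeff_natCast, qPoch_zero]
    simp
  rw [h1] at hlim
  have h2 := ((tendsto_qPoch hp0 hp1 z).mul hlim).congr fun k => (hiter k).symm
  rw [mul_one] at h2
  exact tendsto_nhds_unique tendsto_const_nhds h2

/-- For `j < 0` the product contains the factor `1 - p ^ 0 = 0`, in agreement with the extension of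
`invEulerCoeff` by zero. -/
theorem qPochInf_zpow (j : ℤ) :
    qPochInf (p ^ (j + 1)) p = qPochInf p p * invEulerCoeff p j := by
  rcases lt_or_ge j 0 with hj | hj
  · rw [invEulerCoeff_of_neg p hj, mul_zero]
    refine tprod_of_exists_eq_zero ⟨(-(j + 1)).toNat, ?_⟩
    rw [← zpow_natCast p, ← zpow_add₀ hp0.ne', Int.toNat_of_nonneg (by lia)]
    simp
  · obtain ⟨n, rfl⟩ := Int.eq_ofNat_of_zero_le hj
    rw [invEulerCoeff_natCast, qPochInf_eq_qPoch_mul hp0 hp1 p n]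
    have h1 := (qPoch_pos hp0 hp1 hp1 n).ne'
    rw [← Nat.cast_succ, zpow_natCast, Nat.succ_eq_add_one, pow_succ']
    field_simp

/-- Since `invEulerCoeff` is bounded and supported on `n ≥ 0`, it is at most `C * B ^ n` on all of
`ℤ` for each `B ≥ 1`. Taking `B = 1` gives boundedness, and large `B` gives arbitrarily fast
geometric decay as `m → -∞`. -/
theorem exists_hahnExton_bound {w : ℝ} (hw0 : 0 < w) :
    ∀ B : ℝ, 1 ≤ B → ∃ C, 0 ≤ C ∧ ∀ m : ℤ,
      (Summable fun n : ℤ => |eulerCoeff p n * w ^ n * invEulerCoeff p (n + m)|) ∧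
      |hahnExton p w m| ≤ C * B ^ m := by
  intro B hB
  obtain ⟨C, hC0, hC⟩ := exists_invEulerCoeff_le hp0 hp1
  have hB0 : 0 < B := by linarith
  have hs := summable_eulerCoeff_mul_zpow hp0 hp1 (mul_pos hw0 hB0)
  have hE : ∀ n : ℤ, |invEulerCoeff p n| ≤ C * B ^ n := fun n => by
    rw [abs_of_nonneg (invEulerCoeff_nonneg hp0 hp1 n)]
    rcases lt_or_ge n 0 with hn | hn
    · rw [invEulerCoeff_of_neg p hn]; positivity
    · exact (hC n).trans (le_mul_of_one_le_right hC0.le (one_le_zpow₀ hB hn))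
  have hle : ∀ m n : ℤ, |eulerCoeff p n * w ^ n * invEulerCoeff p (n + m)| ≤
      |eulerCoeff p n| * (w * B) ^ n * (C * B ^ m) := fun m n => by
    rw [abs_mul, abs_mul, abs_of_pos (zpow_pos hw0 n)]
    calc _ ≤ |eulerCoeff p n| * w ^ n * (C * B ^ (n + m)) := by gcongr; exact hE _
      _ = _ := by rw [zpow_add₀ hB0.ne', mul_zpow]; ring
  refine ⟨(∑' n : ℤ, |eulerCoeff p n| * (w * B) ^ n) * C, ?_, fun m => ?_⟩
  · exact mul_nonneg (tsum_nonneg fun n => by positivity) hC0.le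
  · have hsum := (hs.mul_right (C * B ^ m)).of_nonneg_of_le (fun n => abs_nonneg _) (hle m)
    refine ⟨hsum, ?_⟩
    rw [mul_assoc, ← tsum_mul_right]
    exact tsum_of_norm_bounded (f := fun n : ℤ => eulerCoeff p n * w ^ n * invEulerCoeff p (n + m))
      (hs.mul_right (C * B ^ m)).hasSum fun n => hle m n

theorem summable_hahnExton_term {w : ℝ} (hw0 : 0 < w) (m : ℤ) :
    Summable fun n : ℤ => |eulerCoeff p n * w ^ n * invEulerCoeff p (n + m)| :=
  let ⟨_, _, h⟩ := exists_hahnExton_bound hp0 hp1 hw0 1 le_rfl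
  (h m).1

theorem exists_abs_hahnExton_le {w : ℝ} (hw0 : 0 < w) {B : ℝ} (hB : 1 ≤ B) :
    ∃ C, 0 ≤ C ∧ ∀ m : ℤ, |hahnExton p w m| ≤ C * B ^ m :=
  let ⟨C, hC, h⟩ := exists_hahnExton_bound hp0 hp1 hw0 B hB
  ⟨C, hC, fun m => (h m).2⟩

theorem summable_zpow_mul_hahnExton {w : ℝ} (hw0 : 0 < w) {ρ : ℝ} (hρ0 : 0 < ρ) (hρ1 : ρ < 1) :
    Summable fun m : ℤ => ρ ^ m * |hahnExton p w m| := by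
  obtain ⟨C₁, hC₁, h₁⟩ := exists_abs_hahnExton_le hp0 hp1 hw0 le_rfl
  -- This base turns the terms at `-n` into a multiple of `(1 / 2) ^ n`.
  have hB : 1 ≤ 2 / ρ := by rw [le_div_iff₀ hρ0]; linarith
  obtain ⟨C₂, hC₂, h₂⟩ := exists_abs_hahnExton_le hp0 hp1 hw0 hB
  refine Summable.of_nat_of_neg ?_ ?_
  · refine ((summable_geometric_of_lt_one hρ0.le hρ1).mul_right C₁).of_nonneg_of_le
      (fun n => by positivity) fun n => ?_
    rw [zpow_natCast]
    gcongr
    simpa using h₁ n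
  · refine ((summable_geometric_of_lt_one (r := (1 / 2 : ℝ)) (by norm_num)
      (by norm_num)).mul_right C₂).of_nonneg_of_le (fun n => by positivity) fun n => ?_
    calc _ ≤ ρ ^ (-(n : ℤ)) * (C₂ * (2 / ρ) ^ (-(n : ℤ))) := by gcongr; exact h₂ _
      _ = (1 / 2) ^ n * C₂ := by
        rw [← zpow_natCast (1 / 2 : ℝ), one_div, inv_zpow', div_zpow]
        field_simp

/-- The Hahn–Exton `q`-Bessel function on the `q`-lattice, via the symmetry
`(w; p)_∞ ₁φ₁(0; w; p, z) = (z; p)_∞ ₁φ₁(0; z; p, w)`. -/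
theorem qPochInf_mul_tsum_eq_hahnExton {w : ℝ} (hw0 : 0 < w) (hw1 : w < 1) (m : ℤ) :
    qPochInf w p / qPochInf p p *
      ∑' n : ℕ, (-1) ^ n * p ^ (n * (n + 1) / 2) / (qPoch p p n * qPoch w p n) * (p ^ m) ^ n =
    hahnExton p w m := by
  have hsum : Summable fun x : ℕ × ℕ =>
      eulerCoeff p x.1 * (p ^ (m + 1)) ^ x.1 * (eulerCoeff p x.2 * (w * p ^ x.1) ^ x.2) := by
    refine ((summable_nat_eulerCoeff_mul_pow hp0 hp1 (zpow_pos hp0 (m + 1))).mul_of_nonneg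
      (summable_nat_eulerCoeff_mul_pow hp0 hp1 hw0) (fun n => by positivity)
      (fun n => by positivity)).of_norm_bounded fun x => ?_
    have hk : p ^ x.1 ≤ 1 := pow_le_one₀ hp0.le hp1.le
    rw [norm_mul, norm_mul, norm_mul, norm_pow, norm_pow, Real.norm_eq_abs, Real.norm_eq_abs,
      Real.norm_eq_abs, Real.norm_eq_abs, abs_of_pos (zpow_pos hp0 _),
      abs_of_pos (show 0 < w * p ^ x.1 by positivity)]
    gcongr ?_ * (_ * ?_ ^ _)
    exact mul_le_of_le_one_right hw0.le hk
  have hinf := qPochInf_ne_zero hp0 hp1 hp1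
  calc _ = (∑' n : ℕ, qPochInf w p * ((-1) ^ n * p ^ (n * (n + 1) / 2) /
              (qPoch p p n * qPoch w p n) * (p ^ m) ^ n)) / qPochInf p p := by
        rw [tsum_mul_left]; ring
    _ = (∑' n : ℕ, ∑' k : ℕ, eulerCoeff p n * (p ^ (m + 1)) ^ n *
          (eulerCoeff p k * (w * p ^ n) ^ k)) / qPochInf p p := by
        congr 1
        -- The quotient `(w; p)_∞ / (w; p)_n = (w p ^ n; p)_∞` is expanded by Euler's series.
        refine tsum_congr fun n => ?_
        rw [tsum_mul_left, tsum_eulerCoeff_mul_pow hp0 hp1, qPochInf_eq_qPoch_mul hp0 hp1 w n,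
          eulerCoeff_natCast, zpow_add_one₀ hp0.ne', mul_pow]
        have h1 := (qPoch_pos hp0 hp1 hp1 n).ne'
        have h2 := (qPoch_pos hp0 hp1 hw1 n).ne'
        have h3 : n * (n + 1) / 2 = n.choose 2 + n := by
          rw [mul_comm, Nat.choose_two_right]
          exact Nat.triangle_succ n
        rw [h3, pow_add]
        field_simp
    _ = (∑' k : ℕ, ∑' n : ℕ, eulerCoeff p n * (p ^ (m + 1)) ^ n *
          (eulerCoeff p k * (w * p ^ n) ^ k)) / qPochInf p p := by
        rw [Summable.tsum_comm (f := fun k n : ℕ => eulerCoeff p n * (p ^ (m + 1)) ^ n *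
          (eulerCoeff p k * (w * p ^ n) ^ k)) hsum.prod_symm]
    _ = ∑' k : ℕ, eulerCoeff p k * w ^ k * invEulerCoeff p (k + m) := by
        rw [← tsum_div_const]
        refine tsum_congr fun k => ?_
        -- After the interchange the inner sum is again an Euler series, at `z = p ^ (k + m + 1)`.
        have h : ∀ n : ℕ, eulerCoeff p n * (p ^ (m + 1)) ^ n * (eulerCoeff p k * (w * p ^ n) ^ k) =
            eulerCoeff p k * w ^ k * (eulerCoeff p n * (p ^ (k + m + 1 : ℤ)) ^ n) := fun n => by
          rw [show (k + m + 1 : ℤ) = (m + 1) + k by ring, zpow_add₀ hp0.ne' (m + 1), zpow_natCast,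
            mul_pow, mul_pow, ← pow_mul p n k, ← pow_mul p k n, mul_comm n k]
          ring
        rw [tsum_congr h, tsum_mul_left, tsum_eulerCoeff_mul_pow hp0 hp1, qPochInf_zpow hp0 hp1]
        field_simp
    _ = hahnExton p w m := by
        rw [hahnExton, tsum_int_eq_tsum_nat fun n hn => by rw [eulerCoeff_of_neg p hn]; ring]
        simp

end

/-! ### Orthogonality and the vanishing moment. -/

section

variable {p : ℝ} (hp0 : 0 < p) (hp1 : p < 1) {w : ℝ} (hw0 : 0 < w) (hw1 : w < 1)
include hp0 hp1 hw0

/-- As `m → +∞` the argument `q ^ m` tends to `0`. The nonvanishing of this limit for `w < 1` drives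
`tsum_zpow_mul_hahnExton`. -/
theorem tendsto_hahnExton :
    Tendsto (fun m : ℕ => hahnExton p w m) atTop (𝓝 (qPochInf w p / qPochInf p p)) := by
  obtain ⟨C, hC0, hC⟩ := exists_invEulerCoeff_le hp0 hp1
  have hE : Tendsto (fun m : ℕ => invEulerCoeff p m) atTop (𝓝 (qPochInf p p)⁻¹) :=
    (tendsto_qPoch hp0 hp1 p).inv₀ (qPochInf_ne_zero hp0 hp1 hp1)
  have key : Tendsto (fun m : ℕ => ∑' n : ℕ, eulerCoeff p n * w ^ n * invEulerCoeff p (n + m))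
      atTop (𝓝 (∑' n : ℕ, eulerCoeff p n * w ^ n * (qPochInf p p)⁻¹)) := by
    refine tendsto_tsum_of_dominated_convergence
      ((summable_nat_eulerCoeff_mul_pow hp0 hp1 hw0).mul_right C) (fun n => ?_)
      (Eventually.of_forall fun m n => ?_)
    · refine Tendsto.const_mul _ ?_
      simpa [Function.comp_def, add_comm] using hE.comp (tendsto_add_atTop_nat n)
    · rw [norm_mul, norm_mul, norm_pow, Real.norm_eq_abs, Real.norm_eq_abs, Real.norm_eq_abs,
        abs_of_pos hw0, abs_of_nonneg (invEulerCoeff_nonneg hp0 hp1 _)]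
      gcongr
      exact hC _
  rw [tsum_mul_right, tsum_eulerCoeff_mul_pow hp0 hp1, ← div_eq_mul_inv] at key
  refine key.congr fun m => ?_
  rw [hahnExton, tsum_int_eq_tsum_nat fun n hn => by rw [eulerCoeff_of_neg p hn]; ring]
  simp

include hw1

/-- Orthogonality of the Hahn–Exton coefficients, the coefficientwise form of
`G(z) G(w / z) = 1` for `G(z) = (w / z; p)_∞ / (z; p)_∞`. -/
theorem tsum_zpow_mul_hahnExton_mul (s : ℤ) :
    ∑' m : ℤ, w ^ m * (hahnExton p w m * hahnExton p w (m + s)) = if s = 0 then 1 else 0 := by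
  obtain ⟨C, hC0, hC⟩ := exists_invEulerCoeff_le hp0 hp1
  have hE0 := invEulerCoeff_nonneg hp0 hp1
  let G : ℤ × ℤ × ℤ → ℝ := fun x => w ^ x.1 * (eulerCoeff p x.2.1 * w ^ x.2.1 *
    invEulerCoeff p (x.2.1 + x.1) * (eulerCoeff p x.2.2 * w ^ x.2.2 *
      invEulerCoeff p (x.2.2 + (x.1 + s))))
  -- Coordinates `(u, r, n)` with `u = m + n`: one factor `invEulerCoeff` depends on `u` alone and
  -- the other is merely bounded, so `G` has a summable product majorant.
  let e₁ : ℤ × ℤ × ℤ ≃ ℤ × ℤ × ℤ :=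
    { toFun := fun x => (x.1 - x.2.2, x.2.2, x.2.1)
      invFun := fun y => (y.1 + y.2.1, y.2.2, y.2.1)
      left_inv := fun x => by simp
      right_inv := fun y => by simp }
  -- Coordinates `(t, r, n)` with `t = m + n + r`: for fixed `t` the sum splits into two
  -- convolutions of Euler coefficients, equal to `δ_{t,0}` and `δ_{t+s,0}`.
  let e₂ : ℤ × ℤ × ℤ ≃ ℤ × ℤ × ℤ :=
    { toFun := fun x => (x.1 - x.2.2 - x.2.1, x.2.2, x.2.1)
      invFun := fun y => (y.1 + y.2.1 + y.2.2, y.2.2, y.2.1)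
      left_inv := fun x => by ext <;> simp; ring
      right_inv := fun y => by ext <;> simp; ring }
  have hsE : Summable fun u : ℤ => w ^ u * invEulerCoeff p u := by
    rw [← (Nat.cast_injective (R := ℤ)).summable_iff fun n hn => ?_]
    · refine ((summable_geometric_of_lt_one hw0.le hw1).mul_right C).of_nonneg_of_le
        (fun n => mul_nonneg (by positivity) (hE0 _)) fun n => ?_
      simp only [Function.comp, zpow_natCast]
      gcongr
      exact hC _
    · rw [invEulerCoeff_of_neg p, mul_zero]
      by_contra! h
      exact hn ⟨n.toNat, by simp [h]⟩
  have hG : Summable G := by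
    rw [← e₁.summable_iff]
    refine (hsE.mul_of_nonneg ((summable_eulerCoeff_mul_zpow hp0 hp1 hw0).mul_of_nonneg
      ((summable_eulerCoeff_mul_zpow hp0 hp1 one_pos).mul_right C)
      (fun r => by positivity) (fun n => by positivity))
      (fun u => mul_nonneg (by positivity) (hE0 _)) (fun x => by positivity)).of_norm_bounded
        fun x => ?_
    obtain ⟨u, r, n⟩ := x
    have h : (G ∘ e₁) (u, r, n) = (w ^ u * invEulerCoeff p u) * ((eulerCoeff p r * w ^ r) *
        (eulerCoeff p n * invEulerCoeff p (r + (u - n + s)))) := by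
      simp only [G, e₁, Function.comp, Equiv.coe_fn_mk]
      rw [zpow_sub₀ hw0.ne', show n + (u - n) = u by ring]
      field_simp
    rw [h]
    simp only [one_zpow, mul_one]
    rw [norm_mul, norm_mul (eulerCoeff p r * w ^ r), norm_mul (eulerCoeff p n), Real.norm_of_nonneg
      (mul_nonneg (zpow_pos hw0 u).le (hE0 u)), norm_mul, Real.norm_of_nonneg (zpow_pos hw0 r).le,
      Real.norm_of_nonneg (hE0 _), Real.norm_eq_abs, Real.norm_eq_abs]
    have := hE0 u
    gcongr
    exact hC _
  have hP := tsum_invEulerCoeff_mul_eulerCoeff hp0 hp1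
  have hPs : ∀ t : ℤ, Summable fun r : ℤ => ‖invEulerCoeff p (t - r) * eulerCoeff p r‖ :=
    fun t => by
      refine ((summable_eulerCoeff_mul_zpow hp0 hp1 one_pos).mul_left C).of_nonneg_of_le
        (fun r => norm_nonneg _) fun r => ?_
      rw [norm_mul, Real.norm_of_nonneg (hE0 _), one_zpow, mul_one, Real.norm_eq_abs]
      gcongr
      exact hC _
  have hI : ∀ m : ℤ, Summable fun n : ℤ =>
      ‖eulerCoeff p n * w ^ n * invEulerCoeff p (n + m)‖ := fun m => by
    simpa only [Real.norm_eq_abs] using summable_hahnExton_term hp0 hp1 hw0 m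
  have hGI : ∑' m : ℤ, w ^ m * (hahnExton p w m * hahnExton p w (m + s)) = ∑' x, G x := by
    rw [hG.tsum_prod]
    refine tsum_congr fun m => ?_
    rw [hahnExton, hahnExton, tsum_mul_tsum_of_summable_norm (hI m) (hI (m + s)), ← tsum_mul_left]
  rw [hGI, ← e₂.tsum_eq]
  refine (e₂.summable_iff.2 hG).tsum_prod.trans ?_
  have hin : ∀ t : ℤ, ∑' x : ℤ × ℤ, (G ∘ e₂) (t, x) =
      w ^ t * ((if t = 0 then 1 else 0) * if t + s = 0 then 1 else 0) := fun t => by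
    rw [← hP, ← hP, tsum_mul_tsum_of_summable_norm (hPs t) (hPs (t + s)), ← tsum_mul_left]
    refine tsum_congr fun x => ?_
    obtain ⟨r, n⟩ := x
    simp only [G, e₂, Function.comp, Equiv.coe_fn_mk]
    rw [zpow_sub₀ hw0.ne', zpow_sub₀ hw0.ne', show n + (t - n - r) = t - r by ring,
      show r + (t - n - r + s) = t + s - n by ring]
    field_simp
  refine (tsum_congr hin).trans ?_
  rw [tsum_eq_single 0 fun t ht => by simp [ht]]
  simp

/-- Let `s → +∞` in the orthogonality relation: the right side is `0` for `s > 0`, while `hahnExton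
p w (m + s)` tends to a nonzero constant that factors out. -/
theorem tsum_zpow_mul_hahnExton : ∑' m : ℤ, w ^ m * hahnExton p w m = 0 := by
  obtain ⟨C, hC0, hC⟩ := exists_abs_hahnExton_le hp0 hp1 hw0 le_rfl
  have hlim : Tendsto (fun s : ℕ => ∑' m : ℤ, w ^ m * (hahnExton p w m * hahnExton p w (m + s)))
      atTop (𝓝 (∑' m : ℤ, w ^ m * (hahnExton p w m * (qPochInf w p / qPochInf p p)))) := by
    refine tendsto_tsum_of_dominated_convergence
      ((summable_zpow_mul_hahnExton hp0 hp1 hw0 hw0 hw1).mul_right C) (fun m => ?_)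
      (Eventually.of_forall fun s m => ?_)
    · refine (Tendsto.const_mul _ ?_).const_mul _
      -- `toNat` does not truncate once `s ≥ |m|`, so the limit along `ℕ` applies.
      have hshift : Tendsto (fun s : ℕ => (m + s).toNat) atTop atTop :=
        tendsto_atTop.2 fun b => by
          filter_upwards [eventually_ge_atTop (b + m.natAbs)] with s hs
          lia
      refine ((tendsto_hahnExton hp0 hp1 hw0).comp hshift).congr' ?_
      filter_upwards [eventually_ge_atTop m.natAbs] with s hs
      simp only [Function.comp]
      congr 1
      lia
    · rw [norm_mul, norm_mul, Real.norm_eq_abs, Real.norm_eq_abs, Real.norm_eq_abs,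
        abs_of_pos (zpow_pos hw0 m), mul_assoc]
      gcongr
      simpa using hC (m + s)
  have h0 : Tendsto (fun s : ℕ => ∑' m : ℤ, w ^ m * (hahnExton p w m * hahnExton p w (m + s)))
      atTop (𝓝 0) := by
    refine tendsto_const_nhds.congr' ?_
    filter_upwards [eventually_gt_atTop 0] with s hs
    rw [tsum_zpow_mul_hahnExton_mul hp0 hp1 hw0 hw1, if_neg (by lia)]
  have h := tendsto_nhds_unique hlim h0
  simp_rw [← mul_assoc] at h
  rw [tsum_mul_right] at h
  exact (mul_eq_zero.1 h).resolve_right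
    (div_ne_zero (qPochInf_ne_zero hp0 hp1 hw1) (qPochInf_ne_zero hp0 hp1 hp1))

end

/-! ### The Macdonald sequence: summability and inversion. -/

/-- The `q`-Macdonald function on the `q`-lattice, in terms of the Hahn–Exton coefficients. -/
def macdonaldCoeff (p w : ℝ) (k : ℤ) : ℝ :=
  ∑' n : ℤ, w ^ n * (1 + p ^ n)⁻¹ * hahnExton p w (n + k)

theorem exists_base_between {p w : ℝ} (hp1 : p < 1) (hw1 : w < 1) :
    ∃ ρ, w < ρ ∧ p ≤ ρ ∧ ρ < 1 := by
  obtain ⟨ρ, h1, h2⟩ := exists_between (max_lt hw1 hp1)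
  exact ⟨ρ, (le_max_left _ _).trans_lt h1, ((le_max_right _ _).trans_lt h1).le, h2⟩

section

variable {p : ℝ} (hp0 : 0 < p)
include hp0

/-- The bound holds because `ρ ^ n ≤ 1` for `n ≥ 0` and `ρ ^ n ≤ p ^ n` for `n < 0`. A majorant
multiplicative in `n` lets double sums separate; with also `w < ρ < 1`, both `ρ` and `w / ρ` are
admissible weights in `summable_zpow_mul_hahnExton`. -/
theorem inv_one_add_zpow_le {ρ : ℝ} (hpρ : p ≤ ρ) (hρ1 : ρ ≤ 1) (n : ℤ) :
    (1 + p ^ n)⁻¹ ≤ (ρ ^ n)⁻¹ := by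
  have hρ0 : 0 < ρ := hp0.trans_le hpρ
  refine inv_anti₀ (zpow_pos hρ0 n) ?_
  have hpn := zpow_pos hp0 n
  rcases le_or_gt 0 n with hn | hn
  · linarith [zpow_le_one₀ hρ0 hρ1 hn]
  · have h : p ^ (-n) ≤ ρ ^ (-n) := zpow_le_zpow_left₀ (by lia) hp0.le hpρ
    rw [zpow_neg, zpow_neg, inv_le_inv₀ hpn (zpow_pos hρ0 n)] at h
    linarith

variable (hp1 : p < 1) {w : ℝ} (hw0 : 0 < w) (hw1 : w < 1)
include hp1 hw0 hw1

theorem summable_macdonaldCoeff_term (k : ℤ) :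
    Summable fun n : ℤ => w ^ n * (1 + p ^ n)⁻¹ * hahnExton p w (n + k) := by
  have h := (((Equiv.addRight k).summable_iff.2
    (summable_zpow_mul_hahnExton hp0 hp1 hw0 hw0 hw1)).mul_left (w ^ (-k)))
  refine h.of_norm_bounded fun n => ?_
  have hp := zpow_pos hp0 n
  have hw := zpow_pos hw0 n
  have hinv : (1 + p ^ n)⁻¹ ≤ 1 := inv_le_one_of_one_le₀ (by linarith)
  simp only [Function.comp, Equiv.coe_addRight]
  rw [← mul_assoc, ← zpow_add₀ hw0.ne', norm_mul, norm_mul, Real.norm_of_nonneg hw.le,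
    Real.norm_of_nonneg (by positivity), Real.norm_eq_abs, show -k + (n + k) = n by ring]
  gcongr
  exact mul_le_of_le_one_right hw.le hinv

/-- The decay is geometric at both ends: like `ρ ^ k` as `k → +∞`, directly from the majorant, and
like `p ^ k` at index `-k`, thanks to the vanishing moment. -/
theorem summable_zpow_mul_macdonaldCoeff :
    Summable fun k : ℤ => w ^ k * |macdonaldCoeff p w k| := by
  obtain ⟨ρ, hwρ, hpρ, hρ1⟩ := exists_base_between hp1 hw1
  have hρ0 : 0 < ρ := hw0.trans hwρ
  have hshift : ∀ k : ℤ, w ^ k * macdonaldCoeff p w k =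
      ∑' m : ℤ, w ^ m * (1 + p ^ (m - k))⁻¹ * hahnExton p w m := fun k => by
    rw [macdonaldCoeff, ← tsum_mul_left, ← (Equiv.addRight k).tsum_eq fun m : ℤ =>
      w ^ m * (1 + p ^ (m - k))⁻¹ * hahnExton p w m]
    refine tsum_congr fun n => ?_
    simp only [Equiv.coe_addRight]
    rw [zpow_add₀ hw0.ne', add_sub_cancel_right]
    ring
  have habs : ∀ k : ℤ, w ^ k * |macdonaldCoeff p w k| = |w ^ k * macdonaldCoeff p w k| := fun k => by
    rw [abs_mul, abs_of_pos (zpow_pos hw0 k)]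
  have hs1 := summable_zpow_mul_hahnExton hp0 hp1 hw0 (div_pos hw0 hρ0) ((div_lt_one hρ0).2 hwρ)
  have hs2 := summable_zpow_mul_hahnExton hp0 hp1 hw0 (mul_pos hw0 hp0)
    (mul_lt_one_of_nonneg_of_lt_one_left hw0.le hw1 hp1.le)
  refine Summable.of_nat_of_neg ?_ ?_
  · refine ((summable_geometric_of_lt_one hρ0.le hρ1).mul_right
      (∑' m : ℤ, (w / ρ) ^ m * |hahnExton p w m|)).of_nonneg_of_le
      (fun n => by positivity) fun k => ?_
    rw [habs, hshift, ← tsum_mul_left]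
    refine tsum_of_norm_bounded (f := fun m : ℤ => w ^ m * (1 + p ^ (m - (k : ℤ)))⁻¹ *
      hahnExton p w m) (hs1.mul_left _).hasSum fun m => ?_
    have h := inv_one_add_zpow_le hp0 hpρ hρ1.le (m - k)
    have hp := zpow_pos hp0 (m - k)
    rw [norm_mul, norm_mul, Real.norm_of_nonneg (zpow_pos hw0 m).le,
      Real.norm_of_nonneg (by positivity), Real.norm_eq_abs, ← mul_assoc]
    refine mul_le_mul_of_nonneg_right ?_ (abs_nonneg _)
    calc _ ≤ w ^ m * (ρ ^ (m - (k : ℤ)))⁻¹ := by gcongr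
      _ = _ := by rw [zpow_sub₀ hρ0.ne', div_zpow, zpow_natCast]; field_simp
  · refine ((summable_geometric_of_lt_one hp0.le hp1).mul_right
      (∑' m : ℤ, (w * p) ^ m * |hahnExton p w m|)).of_nonneg_of_le
      (fun n => by positivity) fun k => ?_
    have hw := summable_zpow_mul_hahnExton hp0 hp1 hw0 hw0 hw1
    have hI : Summable fun m : ℤ => w ^ m * hahnExton p w m := by
      refine hw.of_norm_bounded fun m => ?_
      rw [norm_mul, Real.norm_of_nonneg (zpow_pos hw0 m).le, Real.norm_eq_abs]
    have hI' : Summable fun m : ℤ => w ^ m * (1 + p ^ (m - -(k : ℤ)))⁻¹ * hahnExton p w m := by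
      refine hw.of_norm_bounded fun m => ?_
      have hp := zpow_pos hp0 (m - -(k : ℤ))
      have hinv : (1 + p ^ (m - -(k : ℤ)))⁻¹ ≤ 1 := inv_le_one_of_one_le₀ (by linarith)
      rw [norm_mul, norm_mul, Real.norm_of_nonneg (zpow_pos hw0 m).le,
        Real.norm_of_nonneg (by positivity), Real.norm_eq_abs]
      gcongr
      exact mul_le_of_le_one_right (zpow_pos hw0 m).le hinv
    -- Subtracting the zero sum replaces `(1 + y)⁻¹` by `(1 + y)⁻¹ - 1 = -y (1 + y)⁻¹` with `y = p ^
    -- (m + k)`, which supplies the factor `p ^ k`.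
    have hsub := hI'.tsum_sub hI
    rw [tsum_zpow_mul_hahnExton hp0 hp1 hw0 hw1, sub_zero] at hsub
    rw [habs, hshift, ← hsub, ← tsum_mul_left]
    refine tsum_of_norm_bounded (f := fun m : ℤ => w ^ m * (1 + p ^ (m - -(k : ℤ)))⁻¹ *
      hahnExton p w m - w ^ m * hahnExton p w m) (hs2.mul_left _).hasSum fun m => ?_
    have hp := zpow_pos hp0 (m - -(k : ℤ))
    have h : w ^ m * (1 + p ^ (m - -(k : ℤ)))⁻¹ * hahnExton p w m - w ^ m * hahnExton p w m =
        -(w ^ m * (p ^ (m - -(k : ℤ)) * (1 + p ^ (m - -(k : ℤ)))⁻¹) * hahnExton p w m) := by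
      field_simp
      ring
    have hinv : (1 + p ^ (m - -(k : ℤ)))⁻¹ ≤ 1 := inv_le_one_of_one_le₀ (by linarith)
    rw [h, norm_neg, norm_mul, norm_mul, Real.norm_of_nonneg (zpow_pos hw0 m).le,
      Real.norm_of_nonneg (by positivity), Real.norm_eq_abs, ← mul_assoc (p ^ k)]
    refine mul_le_mul_of_nonneg_right ?_ (abs_nonneg _)
    have hle := mul_le_mul_of_nonneg_left (mul_le_of_le_one_right hp.le hinv) (zpow_pos hw0 m).le
    refine hle.trans_eq ?_
    rw [sub_neg_eq_add, zpow_add₀ hp0.ne', mul_zpow, zpow_natCast]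
    ring

theorem tsum_macdonaldCoeff_mul_hahnExton (l : ℤ) :
    ∑' k : ℤ, w ^ k * macdonaldCoeff p w k * hahnExton p w (l + k) = (1 + p ^ l)⁻¹ := by
  obtain ⟨ρ, hwρ, hpρ, hρ1⟩ := exists_base_between hp1 hw1
  have hρ0 : 0 < ρ := hw0.trans hwρ
  let H : ℤ × ℤ → ℝ := fun x => w ^ x.1 * (w ^ x.2 * (1 + p ^ x.2)⁻¹ * hahnExton p w (x.2 + x.1)) *
    hahnExton p w (l + x.1)
  -- In the coordinates `j = l + k`, `m = n + k` the majorant separates into `ρ ^ j |h j|` times `(w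
  -- / ρ) ^ m |h m|`, up to the constant `ρ ^ (-l)`.
  let e : ℤ × ℤ ≃ ℤ × ℤ :=
    { toFun := fun x => (x.1 - l, x.2 - (x.1 - l))
      invFun := fun y => (y.1 + l, y.2 + y.1)
      left_inv := fun x => by simp
      right_inv := fun y => by simp }
  have hH : Summable H := by
    rw [← e.summable_iff]
    refine (((summable_zpow_mul_hahnExton hp0 hp1 hw0 hρ0 hρ1).mul_left (ρ ^ (-l))).mul_of_nonneg
      (summable_zpow_mul_hahnExton hp0 hp1 hw0 (div_pos hw0 hρ0) ((div_lt_one hρ0).2 hwρ))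
      (fun m => by positivity) (fun m => by positivity)).of_norm_bounded fun x => ?_
    obtain ⟨j, m⟩ := x
    have hp := zpow_pos hp0 (m - (j - l))
    have h : (H ∘ e) (j, m) = w ^ m * (1 + p ^ (m - (j - l)))⁻¹ *
        (hahnExton p w m * hahnExton p w j) := by
      simp only [H, e, Function.comp, Equiv.coe_fn_mk]
      rw [show m - (j - l) + (j - l) = m by ring, show l + (j - l) = j by ring,
        zpow_sub₀ hw0.ne' m]
      field_simp
    rw [h, norm_mul, norm_mul, norm_mul, Real.norm_of_nonneg (zpow_pos hw0 m).le,
      Real.norm_of_nonneg (by positivity), Real.norm_eq_abs, Real.norm_eq_abs]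
    calc _ ≤ w ^ m * (ρ ^ (m - (j - l)))⁻¹ * (|hahnExton p w m| * |hahnExton p w j|) :=
          mul_le_mul_of_nonneg_right (mul_le_mul_of_nonneg_left
            (inv_one_add_zpow_le hp0 hpρ hρ1.le _) (zpow_pos hw0 m).le) (by positivity)
      _ = _ := by
          simp only
          rw [zpow_sub₀ hρ0.ne', zpow_sub₀ hρ0.ne', zpow_neg, div_zpow]
          field_simp
  calc _ = ∑' k : ℤ, ∑' n : ℤ, H (k, n) := by
        refine tsum_congr fun k => ?_
        simp only [H]
        rw [tsum_mul_right, tsum_mul_left, macdonaldCoeff]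
    _ = ∑' n : ℤ, ∑' k : ℤ, H (k, n) := (Summable.tsum_comm (f := fun k n => H (k, n)) hH).symm
    _ = ∑' n : ℤ, (w ^ (n - l) * (1 + p ^ n)⁻¹) * if n - l = 0 then 1 else 0 := by
        refine tsum_congr fun n => ?_
        rw [← tsum_zpow_mul_hahnExton_mul hp0 hp1 hw0 hw1, ← tsum_mul_left,
          ← (Equiv.subRight l).tsum_eq]
        refine tsum_congr fun m => ?_
        simp only [H, Equiv.subRight_apply]
        rw [show n + (m - l) = m + (n - l) by ring, show l + (m - l) = m by ring,
          zpow_sub₀ hw0.ne' m, zpow_sub₀ hw0.ne' n]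
        field_simp
    _ = (1 + p ^ l)⁻¹ := by
        rw [tsum_eq_single l fun n hn => by rw [if_neg (sub_ne_zero.2 hn), mul_zero]]
        simp

end

/-! ### Translation between Jackson integrals and lattice sums. -/

section

variable {q : ℝ} (hq0 : 0 < q)
include hq0

theorem zpow_mul_rpow (ν : ℝ) (n : ℤ) :
    q ^ n * (q ^ n) ^ (2 * ν + 1) = ((q ^ 2) ^ (ν + 1)) ^ n := by
  have h : ∀ y : ℝ, (q ^ n) ^ y = (q ^ y) ^ n := fun y => by
    rw [← Real.rpow_intCast, ← Real.rpow_intCast, ← Real.rpow_mul hq0.le, ← Real.rpow_mul hq0.le,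
      mul_comm]
  have h2 : (q ^ 2) ^ (ν + 1) = q * q ^ (2 * ν + 1) := by
    rw [← Real.rpow_natCast, ← Real.rpow_mul hq0.le]
    nth_rw 2 [← Real.rpow_one q]
    rw [← Real.rpow_add hq0]
    congr 1
    push_cast
    ring
  rw [h, h2, mul_zpow]

variable (hq1 : q < 1) {ν : ℝ} (hν : -1 < ν)
include hq1 hν

theorem cConst_mul_besselj (m : ℤ) :
    cConst q ν * (1 - q) * besselj ν (q ^ m) (q ^ 2) = hahnExton (q ^ 2) ((q ^ 2) ^ (ν + 1)) m := by
  have hp0 : 0 < q ^ 2 := by positivity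
  have hp1 : q ^ 2 < 1 := pow_lt_one₀ hq0.le hq1 two_ne_zero
  have hw : q ^ (2 * ν + 2) = (q ^ 2) ^ (ν + 1) := by
    rw [← Real.rpow_natCast, ← Real.rpow_mul hq0.le]
    congr 1
    push_cast
    ring
  have h1 : 1 - q ≠ 0 := by linarith
  rw [← qPochInf_mul_tsum_eq_hahnExton hp0 hp1 (by positivity)
    (Real.rpow_lt_one hp0.le hp1 (by linarith)), cConst, hw]
  congr 1
  · field_simp
  · refine tsum_congr fun n => ?_
    rw [pow_mul, ← zpow_natCast (q ^ m) 2, ← zpow_natCast q 2, ← zpow_mul, ← zpow_mul, mul_comm m]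

/-- Nonvanishing lets summability of the normalized lattice terms pass back to the Jackson
integrands. -/
theorem cConst_mul_ne_zero : cConst q ν * (1 - q) ≠ 0 := by
  have hp0 : 0 < q ^ 2 := by positivity
  have hp1 : q ^ 2 < 1 := pow_lt_one₀ hq0.le hq1 two_ne_zero
  have hw1 : q ^ (2 * ν + 2) < 1 := Real.rpow_lt_one hq0.le hq1 (by linarith)
  have h1 : 1 - q ≠ 0 := by linarith
  rw [cConst]
  exact mul_ne_zero (mul_ne_zero (one_div_ne_zero h1)
    (div_ne_zero (qPochInf_ne_zero hp0 hp1 hw1) (qPochInf_ne_zero hp0 hp1 hp1))) h1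

theorem cConst_mul_macdonaldIntegrand (k n : ℤ) :
    cConst q ν * (1 - q) * (q ^ n * macdonaldIntegrand q ν (q ^ k) (q ^ n)) =
      ((q ^ 2) ^ (ν + 1)) ^ n * (1 + (q ^ 2) ^ n)⁻¹ *
        hahnExton (q ^ 2) ((q ^ 2) ^ (ν + 1)) (n + k) := by
  rw [← cConst_mul_besselj hq0 hq1 hν, ← zpow_mul_rpow hq0, macdonaldIntegrand,
    ← zpow_add₀ hq0.ne', ← zpow_natCast, ← zpow_natCast, zpow_comm]
  ring

theorem jacksonIntegrable_macdonaldIntegrand (k : ℤ) :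
    JacksonIntegrable q (macdonaldIntegrand q ν (q ^ k)) := by
  have hp1 : q ^ 2 < 1 := pow_lt_one₀ hq0.le hq1 two_ne_zero
  have h := summable_macdonaldCoeff_term (p := q ^ 2) (by positivity) hp1 (w := (q ^ 2) ^ (ν + 1))
    (by positivity) (Real.rpow_lt_one (by positivity) hp1 (by linarith)) k
  simp_rw [← cConst_mul_macdonaldIntegrand hq0 hq1 hν] at h
  exact (summable_mul_left_iff (cConst_mul_ne_zero hq0 hq1 hν)).1 h

theorem macdonaldK_zpow (k : ℤ) :
    macdonaldK q ν (q ^ k) = macdonaldCoeff (q ^ 2) ((q ^ 2) ^ (ν + 1)) k := by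
  rw [macdonaldK, jacksonIntegral, ← mul_assoc, ← tsum_mul_left, macdonaldCoeff]
  exact tsum_congr fun n => cConst_mul_macdonaldIntegrand hq0 hq1 hν k n

theorem macdonaldK_mem_qLp : macdonaldK q ν ∈ qLp q 1 ν := by
  have hp1 : q ^ 2 < 1 := pow_lt_one₀ hq0.le hq1 two_ne_zero
  refine (summable_zpow_mul_macdonaldCoeff (p := q ^ 2) (by positivity) hp1
    (w := (q ^ 2) ^ (ν + 1)) (by positivity)
    (Real.rpow_lt_one (by positivity) hp1 (by linarith))).congr fun k => ?_
  beta_reduce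
  rw [macdonaldK_zpow hq0 hq1 hν, Real.rpow_one, ← zpow_mul_rpow hq0]
  ring

theorem cConst_mul_fourierIntegrand_macdonaldK (l k : ℤ) :
    cConst q ν * (1 - q) * (q ^ k * fourierIntegrand q ν (macdonaldK q ν) (q ^ l) (q ^ k)) =
      ((q ^ 2) ^ (ν + 1)) ^ k * macdonaldCoeff (q ^ 2) ((q ^ 2) ^ (ν + 1)) k *
        hahnExton (q ^ 2) ((q ^ 2) ^ (ν + 1)) (l + k) := by
  rw [← cConst_mul_besselj hq0 hq1 hν, ← zpow_mul_rpow hq0, fourierIntegrand,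
    macdonaldK_zpow hq0 hq1 hν, ← zpow_add₀ hq0.ne']
  ring

theorem jacksonIntegrable_fourierIntegrand_macdonaldK (l : ℤ) :
    JacksonIntegrable q (fourierIntegrand q ν (macdonaldK q ν) (q ^ l)) := by
  have hp0 : 0 < q ^ 2 := by positivity
  have hp1 : q ^ 2 < 1 := pow_lt_one₀ hq0.le hq1 two_ne_zero
  have hw0 : 0 < (q ^ 2) ^ (ν + 1) := by positivity
  have hw1 : (q ^ 2) ^ (ν + 1) < 1 := Real.rpow_lt_one hp0.le hp1 (by linarith)
  -- With base `1` the kernel is bounded, so integrability of `K_ν` suffices.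
  obtain ⟨C, -, hC⟩ := exists_abs_hahnExton_le hp0 hp1 hw0 le_rfl
  refine (summable_mul_left_iff (cConst_mul_ne_zero hq0 hq1 hν)).1 ?_
  refine ((summable_zpow_mul_macdonaldCoeff hp0 hp1 hw0 hw1).mul_right C).of_norm_bounded
    fun k => ?_
  rw [cConst_mul_fourierIntegrand_macdonaldK hq0 hq1 hν, norm_mul, norm_mul,
    Real.norm_of_nonneg (zpow_pos hw0 k).le, Real.norm_eq_abs, Real.norm_eq_abs]
  gcongr
  simpa using hC (l + k)

theorem qFourier_macdonaldK (l : ℤ) :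
    qFourier q ν (macdonaldK q ν) (q ^ l) = (1 + (q ^ l) ^ 2)⁻¹ := by
  have hp1 : q ^ 2 < 1 := pow_lt_one₀ hq0.le hq1 two_ne_zero
  rw [qFourier, jacksonIntegral, ← mul_assoc, ← tsum_mul_left]
  simp_rw [cConst_mul_fourierIntegrand_macdonaldK hq0 hq1 hν]
  rw [tsum_macdonaldCoeff_mul_hahnExton (by positivity) hp1 (by positivity)
    (Real.rpow_lt_one (by positivity) hp1 (by linarith)), ← zpow_natCast, ← zpow_natCast, zpow_comm]

end

end QBessel

end

theorem mainTheorem5 (q ν : ℝ) (hq0 : 0 < q) (hq1 : q < 1) (hν : -1 < ν)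
    (hνN : ∀ m : ℕ, 1 ≤ m → ν ≠ (m : ℝ)) :
    (∀ x ∈ QBessel.qHalfLine q,
      QBessel.JacksonIntegrable q (QBessel.macdonaldIntegrand q ν x)) ∧
    QBessel.macdonaldK q ν ∈ QBessel.qLp q 1 ν ∧
    ∀ x ∈ QBessel.qHalfLine q,
      QBessel.JacksonIntegrable q
        (QBessel.fourierIntegrand q ν (QBessel.macdonaldK q ν) x) ∧
      QBessel.qFourier q ν (QBessel.macdonaldK q ν) x = (1 + x ^ 2)⁻¹ := by
  refine ⟨?_, QBessel.macdonaldK_mem_qLp hq0 hq1 hν, ?_⟩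
  · rintro _ ⟨k, rfl⟩
    exact QBessel.jacksonIntegrable_macdonaldIntegrand hq0 hq1 hν k
  · rintro _ ⟨l, rfl⟩
    exact ⟨QBessel.jacksonIntegrable_fourierIntegrand_macdonaldK hq0 hq1 hν l,
      QBessel.qFourier_macdonaldK hq0 hq1 hν l⟩
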